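/- Let $(V,\omega)$ be a real symplectic vector space of dimension $2n$, i.e. $\omega$ is a nondegenerate real alternating $2$-form on $V$. Let $(\Lambda^n_{\mathrm{pr}}V^\vee)\otimes\mathbb{C}$ be the finite-dimensional real vector space of $\mathbb{C}$-valued $\mathbb{R}$-multilinear alternating $n$-forms $\Omega$ on $V$ that are primitive, i.e. $\omega\wedge\Omega=0$. Let $\mathcal U(V)\subset(\Lambda^n_{\mathrm{pr}}V^\vee)\otimes\mathbb{C}$ be the set of those $\Omega$ whose pullback $\Omega|_L$ is non-zero for every Lagrangian subspace $L\subset V$ (i.e. every subspace $L$ equal to its own $\omega$-orthogonal complement). Then $\mathcal U(V)$ is open in $(\Lambda^n_{\mathrm{pr}}V^\vee)\otimes\mathbb{C}$, for the standard topology of a finite-dimensional real vector space, and it is semialgebraic: in any system of real linear coordinates it is a finite union of sets, each defined by finitely many equations $p=0$ and strict inequalities $q>0$ with $p,q$ real polynomials. -/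

import Mathlib

open scoped Topology

namespace LagrangianForms

/-! ### Symplectic linear algebra -/

section Forms

variable {V : Type*} [AddCommGroup V] [Module ℝ V]

/-- A real alternating `2`-form is symplectic if it is nondegenerate. -/
def IsSymplecticForm (ω : V [⋀^Fin 2]→ₗ[ℝ] ℝ) : Prop :=
  ∀ x : V, (∀ y : V, ω ![x, y] = 0) → x = 0

/-- A subspace is Lagrangian if it equals its own `ω`-orthogonal complement. -/
def IsLagrangian (ω : V [⋀^Fin 2]→ₗ[ℝ] ℝ) (L : Submodule ℝ V) : Prop :=
  ∀ x : V, x ∈ L ↔ ∀ y ∈ L, ω ![x, y] = 0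

/-- The wedge product of a real-valued and a complex-valued alternating form. -/
noncomputable def wedge {ι κ : Type*} [Fintype ι] [Fintype κ] [DecidableEq ι] [DecidableEq κ]
    (α : V [⋀^ι]→ₗ[ℝ] ℝ) (Ω : V [⋀^κ]→ₗ[ℝ] ℂ) : V [⋀^ι ⊕ κ]→ₗ[ℝ] ℂ :=
  (TensorProduct.lid ℝ ℂ).toLinearMap.compAlternatingMap (α.domCoprod Ω)

theorem wedge_add {ι κ : Type*} [Fintype ι] [Fintype κ] [DecidableEq ι] [DecidableEq κ]
    (α : V [⋀^ι]→ₗ[ℝ] ℝ) (Ω₁ Ω₂ : V [⋀^κ]→ₗ[ℝ] ℂ) :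
    wedge α (Ω₁ + Ω₂) = wedge α Ω₁ + wedge α Ω₂ := by
  simp only [wedge, ← AlternatingMap.domCoprod'_apply, TensorProduct.tmul_add, map_add,
    LinearMap.compAlternatingMap_add]

theorem wedge_smul {ι κ : Type*} [Fintype ι] [Fintype κ] [DecidableEq ι] [DecidableEq κ]
    (α : V [⋀^ι]→ₗ[ℝ] ℝ) (c : ℝ) (Ω : V [⋀^κ]→ₗ[ℝ] ℂ) :
    wedge α (c • Ω) = c • wedge α Ω := by
  simp only [wedge, ← AlternatingMap.domCoprod'_apply, TensorProduct.tmul_smul, map_smul,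
    LinearMap.compAlternatingMap_smul]

/-- The real vector space `(Λⁿ_pr V^∨) ⊗ ℂ` of complex-valued alternating `n`-forms `Ω` on a
symplectic vector space `(V, ω)` of dimension `2n` which are primitive, i.e. `ω ∧ Ω = 0`. -/
def primitiveForms (ω : V [⋀^Fin 2]→ₗ[ℝ] ℝ) (n : ℕ) : Submodule ℝ (V [⋀^Fin n]→ₗ[ℝ] ℂ) where
  carrier := {Ω | wedge ω Ω = 0}
  add_mem' {Ω₁ Ω₂} h₁ h₂ := by
    change wedge ω (Ω₁ + Ω₂) = 0
    change wedge ω Ω₁ = 0 at h₁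
    change wedge ω Ω₂ = 0 at h₂
    rw [wedge_add, h₁, h₂, add_zero]
  zero_mem' := by
    have h := wedge_smul ω 0 (0 : V [⋀^Fin n]→ₗ[ℝ] ℂ)
    rwa [zero_smul, zero_smul] at h
  smul_mem' c Ω h := by
    change wedge ω (c • Ω) = 0
    change wedge ω Ω = 0 at h
    rw [wedge_smul, h, smul_zero]

instance finiteDimensional_alternatingMap [FiniteDimensional ℝ V] (n : ℕ) :
    FiniteDimensional ℝ (V [⋀^Fin n]→ₗ[ℝ] ℂ) :=
  Module.Finite.of_injective
    (AlternatingMap.toMultilinearMapLM :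
      (V [⋀^Fin n]→ₗ[ℝ] ℂ) →ₗ[ℝ] MultilinearMap ℝ (fun _ : Fin n => V) ℂ)
    AlternatingMap.coe_multilinearMap_injective

/-- The set `𝒰(V)` of primitive complex `n`-forms whose pullback to every Lagrangian subspace
is nonzero. -/
def nonvanishingForms (ω : V [⋀^Fin 2]→ₗ[ℝ] ℝ) (n : ℕ) : Set (primitiveForms ω n) :=
  {Ω | ∀ L : Submodule ℝ V, IsLagrangian ω L →
    (Ω : V [⋀^Fin n]→ₗ[ℝ] ℂ).compLinearMap L.subtype ≠ 0}

end Forms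

/-! ### Semialgebraic sets -/

/-- A subset of `ℝᵐ` is semialgebraic if it is a finite union of sets, each defined by finitely
many polynomial equations `p = 0` and strict polynomial inequalities `q > 0`. -/
def IsSemialgebraicCoord {m : ℕ} (S : Set (Fin m → ℝ)) : Prop :=
  ∃ (k : ℕ) (F G : Fin k → Finset (MvPolynomial (Fin m) ℝ)),
    S = ⋃ i, {x | (∀ p ∈ F i, MvPolynomial.eval x p = 0) ∧
      (∀ q ∈ G i, 0 < MvPolynomial.eval x q)}

/-- A subset of a finite-dimensional real vector space is semialgebraic if it is so in every
system of linear coordinates. -/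
def IsSemialgebraic {W : Type*} [AddCommGroup W] [Module ℝ W] [FiniteDimensional ℝ W]
    (S : Set W) : Prop :=
  ∀ (m : ℕ) (e : W ≃ₗ[ℝ] (Fin m → ℝ)), IsSemialgebraicCoord (e '' S)

end LagrangianForms

/-! A form lies outside `𝒰(V)` exactly when it vanishes on some Lagrangian frame. In a fixed basis
of `V` the frame may be taken orthonormal for the coordinate inner product. Orthonormality, isotropy
and vanishing are then polynomial equations in the frame `v` and the coordinates `x` of the form
(`notMem_image_nonvanishingForms_iff`), so the complement of `𝒰(V)` is a projection along `v`.

Openness: orthonormal isotropic frames form a compact set, and projection along a compact space is a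
closed map.

Semialgebraicity is Tarski–Seidenberg, proved in the form: the sign vectors that finitely many
polynomials realise on the fibre over a real point depend only on the signs of finitely many
coefficient expressions at that point. By induction on the number of variables it suffices to
eliminate one. A finite family is closed under derivatives, truncations and pseudo-remainders
(`exists_isSignClosed_superset`). If two points give equal signs to the leading coefficients, the
real lines over them are cut into matching cells, adding polynomials in order of degree
(`IsSignClosed.exists_cellMatching`). A new polynomial is strictly monotone on each open cell by the
sign of its derivative, and its sign at a point cell, a root of an earlier polynomial, is that of a
pseudo-remainder; this determines how its zeros refine the cells (`CellMatching.refine`). -/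

namespace LagrangianForms

/-! ### Matching of cell decompositions of the real line -/

open Set Polynomial

/-- Two monotone labellings of the real line by cells with the same labels in use, such that cells
with the same label are either both open or both single points. -/
structure CellMatching {I : Type} [LinearOrder I] (c d : ℝ → I) : Prop where
  mono_left : Monotone c
  mono_right : Monotone d
  range_eq : range c = range d
  dichotomy : ∀ t u, c t = d u →
    (IsOpen (c ⁻¹' {c t}) ∧ IsOpen (d ⁻¹' {c t})) ∨
      (c ⁻¹' {c t} = {t} ∧ d ⁻¹' {c t} = {u})

namespace CellMatching

variable {I : Type} [LinearOrder I] {c d : ℝ → I}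

theorem symm (h : CellMatching c d) : CellMatching d c where
  mono_left := h.mono_right
  mono_right := h.mono_left
  range_eq := h.range_eq.symm
  dichotomy t u e := by
    rw [e]
    exact (h.dichotomy u t e.symm).imp And.symm And.symm

theorem exists_right (h : CellMatching c d) (t : ℝ) : ∃ u, c t = d u := by
  have : c t ∈ range d := h.range_eq ▸ mem_range_self t
  obtain ⟨u, hu⟩ := this
  exact ⟨u, hu.symm⟩

/-- The reflection `t ↦ -t` exchanges the two ends of a cell; dualising the labels keeps them
monotone. -/
theorem reflect (h : CellMatching c d) :
    CellMatching (fun t => OrderDual.toDual (c (-t))) (fun t => OrderDual.toDual (d (-t))) where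
  mono_left s t hst := OrderDual.toDual_le_toDual.2 (h.mono_left (neg_le_neg hst))
  mono_right s t hst := OrderDual.toDual_le_toDual.2 (h.mono_right (neg_le_neg hst))
  range_eq := by
    ext i
    constructor
    · rintro ⟨t, rfl⟩
      obtain ⟨u, hu⟩ := h.exists_right (-t)
      exact ⟨-u, by simp [hu]⟩
    · rintro ⟨t, rfl⟩
      obtain ⟨u, hu⟩ := h.symm.exists_right (-t)
      exact ⟨-u, by simp [hu]⟩
  dichotomy t u e := by
    rcases h.dichotomy (-t) (-u) (OrderDual.toDual.injective e) with ⟨h₁, h₂⟩ | ⟨h₁, h₂⟩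
    · exact .inl ⟨h₁.preimage continuous_neg, h₂.preimage continuous_neg⟩
    · refine .inr ⟨?_, ?_⟩
      · ext s
        have := Set.ext_iff.1 h₁ (-s)
        simpa using this
      · ext s
        have := Set.ext_iff.1 h₂ (-s)
        simpa using this

/-- On matched open cells on which the functions increase, negative values are transferred, as
they are detected by the left end point of the cell. -/
theorem exists_neg (h : CellMatching c d) {i : I}
    (hG : IsOpen (d ⁻¹' {i})) {f g : ℝ → ℝ} (hfc : Continuous f)
    (hgc : Continuous g) (hf : StrictMonoOn f (c ⁻¹' {i}))
    (hpt : ∀ t u, c t = d u → c ⁻¹' {c t} = {t} → SignType.sign (f t) = SignType.sign (g u))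
    (hgu : ∀ u, (∀ s ≤ u, d s = i) → ∃ s ≤ u, g s < 0)
    (hneg : ∃ s, c s = i ∧ f s < 0) : ∃ s, d s = i ∧ g s < 0 := by
  obtain ⟨s, hs, hfs⟩ := hneg
  obtain ⟨u, hu⟩ := h.exists_right s
  rw [hs] at hu
  by_cases hb : BddBelow (d ⁻¹' {i})
  · have hne : (d ⁻¹' {i}).Nonempty := ⟨u, hu.symm⟩
    set a' := sInf (d ⁻¹' {i}) with ha'
    have hglb : IsGLB (d ⁻¹' {i}) a' := isGLB_csInf hne hb
    have hcl : a' ∈ closure (d ⁻¹' {i}) := csInf_mem_closure hne hb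
    have ha'G : d a' ≠ i := by
      intro hmem
      obtain ⟨l, hl, hlG⟩ := exists_Ioc_subset_of_mem_nhds (hG.mem_nhds hmem) ⟨a' - 1, by simp⟩
      have : (l + a') / 2 ∈ d ⁻¹' {i} := hlG ⟨by linarith, by linarith⟩
      have := hglb.1 this
      linarith
    have hlt : d a' < i := lt_of_le_of_ne (hu ▸ h.mono_right (hglb.1 hu.symm)) ha'G
    obtain ⟨a, ha⟩ := h.symm.exists_right a'
    -- The end point `a'` is a point cell: an open cell around it would meet the cell `i`, whose
    -- closure contains `a'`.
    rcases h.dichotomy a a' ha.symm with ⟨-, ho⟩ | ⟨h₁, h₂⟩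
    · exfalso
      obtain ⟨r, hr, hr'⟩ := mem_closure_iff.1 hcl _ ho ha
      exact ha'G (ha.trans (hr.symm.trans hr'))
    · have has : a < s := by
        by_contra hcon
        have := h.mono_left (not_lt.1 hcon)
        rw [hs, ← ha] at this
        exact absurd hlt (not_lt.2 this)
      -- No cell lies between the point cell `a` and the cell `i`: its match would lie below the
      -- cell `i` of `d`, hence at or before the infimum `a'`.
      have hin : ∀ r ∈ Ioo a s, c r = i := by
        intro r hr
        by_contra hri
        have hle : c r < i := lt_of_le_of_ne (hs ▸ h.mono_left hr.2.le) hri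
        obtain ⟨v, hv⟩ := h.exists_right r
        have hvlb : v ∈ lowerBounds (d ⁻¹' {i}) := by
          intro w hw
          by_contra hcon
          have := h.mono_right (not_le.1 hcon).le
          rw [mem_preimage, mem_singleton_iff] at hw
          rw [hw, ← hv] at this
          exact absurd hle (not_lt.2 this)
        have hva : v ≤ a' := hglb.2 hvlb
        have : c r ≤ c a := by rw [hv, ← ha]; exact h.mono_right hva
        have hra : r ∈ c ⁻¹' {c a} := le_antisymm this (h.mono_left hr.1.le)
        rw [h₁] at hra
        exact absurd hr.1 (by rw [mem_singleton_iff.1 hra]; exact lt_irrefl _)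
      have hfa : f a ≤ f s := by
        have hsub : Ioo a s ⊆ {r | f r ≤ f s} := fun r hr => (hf (hin r hr) hs hr.2).le
        have := closure_minimal hsub (isClosed_le hfc continuous_const)
        rw [closure_Ioo has.ne] at this
        exact this ⟨le_rfl, has.le⟩
      have hsg := hpt a a' ha.symm h₁
      rw [sign_neg (hfa.trans_lt hfs), eq_comm, sign_eq_neg_one_iff] at hsg
      obtain ⟨r, hr, hr'⟩ := mem_closure_iff.1 hcl _ (isOpen_lt hgc continuous_const) hsg
      exact ⟨r, hr', hr⟩
  · have hlow : ∀ r ≤ u, d r = i := by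
      intro r hr
      rw [not_bddBelow_iff] at hb
      obtain ⟨w, hw, hwr⟩ := hb r
      exact le_antisymm (hu ▸ h.mono_right hr) ((mem_singleton_iff.1 hw) ▸ h.mono_right hwr.le)
    obtain ⟨r, hr, hgr⟩ := hgu u hlow
    exact ⟨r, hlow r hr, hgr⟩

theorem exists_pos (h : CellMatching c d) {i : I}
    (hG : IsOpen (d ⁻¹' {i})) {f g : ℝ → ℝ} (hfc : Continuous f)
    (hgc : Continuous g) (hf : StrictMonoOn f (c ⁻¹' {i}))
    (hpt : ∀ t u, c t = d u → c ⁻¹' {c t} = {t} → SignType.sign (f t) = SignType.sign (g u))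
    (hgu : ∀ u, (∀ s ≥ u, d s = i) → ∃ s ≥ u, 0 < g s)
    (hpos : ∃ s, c s = i ∧ 0 < f s) : ∃ s, d s = i ∧ 0 < g s := by
  obtain ⟨s, hs, hfs⟩ := hpos
  obtain ⟨r, hr, hgr⟩ := h.reflect.exists_neg (i := OrderDual.toDual i)
    (f := fun t => -f (-t)) (g := fun t => -g (-t)) (hG.preimage continuous_neg)
    (by fun_prop) (by fun_prop)
    (fun s hs t ht hst => neg_lt_neg (hf ht hs (neg_lt_neg hst)))
    (fun t u e ht => by
      rw [Left.sign_neg, Left.sign_neg, hpt (-t) (-u) (OrderDual.toDual.injective e) ?_]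
      ext s
      have := Set.ext_iff.1 ht (-s)
      simpa [neg_eq_iff_eq_neg] using this)
    (fun u hu => by
      obtain ⟨s, hs, hgs⟩ := hgu (-u) fun s hs => by
        have := hu (-s) (neg_le.1 hs)
        rw [neg_neg] at this
        exact OrderDual.toDual.injective this
      exact ⟨-s, neg_le.1 hs, by simpa using hgs⟩)
    ⟨-s, by simpa using hs, by simpa using hfs⟩
  exact ⟨-r, OrderDual.toDual.injective hr, by simpa using hgr⟩

end CellMatching

/-! ### Refinement of matched cells by the zeros of a polynomial -/

/-- Otherwise `g` is nonnegative and increasing on the left ray, hence bounded there, and a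
polynomial bounded on a ray is constant. -/
theorem exists_eval_neg_of_derivative_pos {g : ℝ[X]} (hg : 0 < g.natDegree) {u : ℝ}
    (hder : ∀ s ≤ u, 0 < g.derivative.eval s) : ∃ s ≤ u, g.eval s < 0 := by
  by_contra! hcon
  have hmono : MonotoneOn (fun s => g.eval s) (Iic u) :=
    monotoneOn_of_deriv_nonneg (convex_Iic u) g.continuous.continuousOn
      g.differentiable.differentiableOn fun s hs => by
        rw [Polynomial.deriv]
        have hs' : s ∈ Iic u := interior_subset hs
        exact (hder s hs').le
  have hb : Filter.IsBoundedUnder (· ≤ ·) Filter.atTop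
      (fun s => |(g.comp (-X)).eval s|) := by
    refine ⟨g.eval u, Filter.eventually_map.2 ?_⟩
    filter_upwards [Filter.eventually_ge_atTop (-u)] with s hs
    have hs' : -s ≤ u := neg_le.1 hs
    have e : (g.comp (-X)).eval s = g.eval (-s) := by simp
    rw [e, abs_of_nonneg (hcon _ hs')]
    exact hmono hs' self_mem_Iic hs'
  have := (Polynomial.isBoundedUnder_abs_atTop_iff _).1 hb
  have h2 := Polynomial.natDegree_le_of_degree_le (n := 0) this
  rw [natDegree_comp, natDegree_neg, natDegree_X] at h2
  omega

theorem exists_eval_pos_of_derivative_pos {g : ℝ[X]} (hg : 0 < g.natDegree) {u : ℝ}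
    (hder : ∀ s ≥ u, 0 < g.derivative.eval s) : ∃ s ≥ u, 0 < g.eval s := by
  obtain ⟨s, hs, h⟩ := exists_eval_neg_of_derivative_pos (g := -g.comp (-X)) (u := -u)
    (by rw [natDegree_neg, natDegree_comp, natDegree_neg, natDegree_X]; omega) (fun s hs => by
      have := hder (-s) (le_neg.1 hs)
      simpa [derivative_comp] using this)
  exact ⟨-s, le_neg.1 hs, by simpa using h⟩

theorem strictMonoOn_eval_of_derivative_pos {f : ℝ[X]} {s : Set ℝ} (hs : s.OrdConnected)
    (hf : ∀ t ∈ s, 0 < f.derivative.eval t) : StrictMonoOn (fun t => f.eval t) s :=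
  strictMonoOn_of_deriv_pos hs.convex f.continuous.continuousOn fun t ht => by
    rw [Polynomial.deriv]
    exact hf t (interior_subset ht)

theorem exists_derivative_ne_zero {f : ℝ[X]} (hf : 0 < f.natDegree) {s : Set ℝ} (hs : IsOpen s)
    (hne : s.Nonempty) : ∃ t ∈ s, f.derivative.eval t ≠ 0 := by
  by_contra! hcon
  have h0 : f.derivative = 0 := by
    obtain ⟨t, ht⟩ := hne
    refine Polynomial.eq_zero_of_infinite_isRoot _
      ((infinite_of_mem_nhds t (hs.mem_nhds ht)).mono fun r hr => hcon r hr)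
  exact hf.ne' (derivative_eq_zero.1 h0)

/-- The refinement of a cell labelling by the zeros of a polynomial whose derivative has constant
sign on each cell. -/
noncomputable def refineCells {I : Type} (c : ℝ → I) (f : ℝ[X]) (t : ℝ) : I ×ₗ SignType :=
  toLex (c t, SignType.sign (f.derivative.eval t) * SignType.sign (f.eval t))

theorem refineCells_eq_iff {I : Type} {c d : ℝ → I} {f g : ℝ[X]} {t u : ℝ} :
    refineCells c f t = refineCells d g u ↔ c t = d u ∧
      SignType.sign (f.derivative.eval t) * SignType.sign (f.eval t) =
        SignType.sign (g.derivative.eval u) * SignType.sign (g.eval u) := by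
  simp [refineCells]


namespace CellMatching

variable {I : Type} [LinearOrder I] {c d : ℝ → I} {f g : ℝ[X]}

theorem ordConnected_left (h : CellMatching c d) (i : I) : (c ⁻¹' {i}).OrdConnected :=
  ordConnected_singleton.preimage_mono h.mono_left

/-- The sign of `f'` is constant on a cell, being compared with one matched point, and a nonzero
polynomial cannot vanish on an open set. -/
theorem derivative_ne_zero_of_isOpen (h : CellMatching c d) (hf : 0 < f.natDegree)
    (hder : ∀ t u, c t = d u →
      SignType.sign (f.derivative.eval t) = SignType.sign (g.derivative.eval u))
    {t : ℝ} (ho : IsOpen (c ⁻¹' {c t})) : f.derivative.eval t ≠ 0 := by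
  obtain ⟨s, hs, hne⟩ := exists_derivative_ne_zero hf ho ⟨t, rfl⟩
  obtain ⟨u, hu⟩ := h.exists_right t
  rw [← sign_ne_zero, hder t u hu, ← hder s u (hs.trans hu), sign_ne_zero]
  exact hne

theorem exists_sign_eq_of_pos (h : CellMatching c d) (hg : 0 < g.natDegree)
    (hpt : ∀ t u, c t = d u → c ⁻¹' {c t} = {t} →
      SignType.sign (f.eval t) = SignType.sign (g.eval u)) {t : ℝ}
    (hF : IsOpen (c ⁻¹' {c t})) (hG : IsOpen (d ⁻¹' {c t}))
    (hfpos : ∀ s, c s = c t → 0 < f.derivative.eval s)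
    (hgpos : ∀ s, d s = c t → 0 < g.derivative.eval s) :
    ∃ u, d u = c t ∧ SignType.sign (g.eval u) = SignType.sign (f.eval t) := by
  have hf := strictMonoOn_eval_of_derivative_pos (h.ordConnected_left (c t)) hfpos
  have hneg : (∃ s, c s = c t ∧ f.eval s < 0) → ∃ s, d s = c t ∧ g.eval s < 0 :=
    h.exists_neg hG f.continuous g.continuous hf hpt fun u hu =>
      exists_eval_neg_of_derivative_pos hg fun s hs => hgpos s (hu s hs)
  have hpos : (∃ s, c s = c t ∧ 0 < f.eval s) → ∃ s, d s = c t ∧ 0 < g.eval s :=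
    h.exists_pos hG f.continuous g.continuous hf hpt fun u hu =>
      exists_eval_pos_of_derivative_pos hg fun s hs => hgpos s (hu s hs)
  rcases lt_trichotomy (f.eval t) 0 with h0 | h0 | h0
  · obtain ⟨u, hu, hgu⟩ := hneg ⟨t, rfl, h0⟩
    exact ⟨u, hu, by rw [sign_neg hgu, sign_neg h0]⟩
  -- At a zero, `f` takes both signs nearby in the cell; both transfer to `g`, and the intermediate
  -- value theorem gives a zero of `g`.
  · have hnear := hF.mem_nhds (rfl : t ∈ c ⁻¹' {c t})
    obtain ⟨l, hl, hlF⟩ := exists_Ioc_subset_of_mem_nhds hnear ⟨t - 1, by simp⟩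
    obtain ⟨r, hr, hrF⟩ := exists_Ico_subset_of_mem_nhds hnear ⟨t + 1, by simp⟩
    have hlt : (l + t) / 2 ∈ c ⁻¹' {c t} := hlF ⟨by linarith, by linarith⟩
    have hrt : (t + r) / 2 ∈ c ⁻¹' {c t} := hrF ⟨by linarith, by linarith⟩
    obtain ⟨u₁, hu₁, hg₁⟩ := hneg ⟨_, hlt, h0 ▸ hf hlt rfl (by linarith)⟩
    obtain ⟨u₂, hu₂, hg₂⟩ := hpos ⟨_, hrt, h0 ▸ hf rfl hrt (by linarith)⟩
    obtain ⟨u, hu, hgu⟩ := (h.symm.ordConnected_left (c t)).isPreconnected.intermediate_value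
      hu₁ hu₂ g.continuous.continuousOn ⟨hg₁.le, hg₂.le⟩
    exact ⟨u, hu, by simp only at hgu; rw [hgu, h0]⟩
  · obtain ⟨u, hu, hgu⟩ := hpos ⟨t, rfl, h0⟩
    exact ⟨u, hu, by rw [sign_pos hgu, sign_pos h0]⟩

theorem exists_refineCells_eq (h : CellMatching c d) (hf : 0 < f.natDegree)
    (hg : 0 < g.natDegree)
    (hder : ∀ t u, c t = d u →
      SignType.sign (f.derivative.eval t) = SignType.sign (g.derivative.eval u))
    (hpt : ∀ t u, c t = d u → c ⁻¹' {c t} = {t} →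
      SignType.sign (f.eval t) = SignType.sign (g.eval u)) (t : ℝ) :
    ∃ u, refineCells c f t = refineCells d g u := by
  obtain ⟨u, hu⟩ := h.exists_right t
  rcases h.dichotomy t u hu with ⟨hF, hG⟩ | ⟨hF, -⟩
  · suffices ∃ u, d u = c t ∧ SignType.sign (g.eval u) = SignType.sign (f.eval t) by
      obtain ⟨v, hv, hs⟩ := this
      exact ⟨v, refineCells_eq_iff.2 ⟨hv.symm, by rw [hs, hder t v hv.symm]⟩⟩
    have hft : ∀ s, c s = c t →
        SignType.sign (f.derivative.eval s) = SignType.sign (f.derivative.eval t) :=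
      fun s hs => (hder s u (hs.trans hu)).trans (hder t u hu).symm
    have hgt : ∀ s, d s = c t →
        SignType.sign (g.derivative.eval s) = SignType.sign (f.derivative.eval t) :=
      fun s hs => (hder t s hs.symm).symm
    rcases lt_or_gt_of_ne (h.derivative_ne_zero_of_isOpen hf hder hF) with h0 | h0
    · rw [sign_neg h0] at hft hgt
      obtain ⟨v, hv, hs⟩ := h.exists_sign_eq_of_pos (f := -f) (g := -g)
        (by rwa [natDegree_neg])
        (fun t u e he => by
          rw [eval_neg, eval_neg, Left.sign_neg, Left.sign_neg, hpt t u e he]) hF hG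
        (fun s hs => by simpa using sign_eq_neg_one_iff.1 (hft s hs))
        (fun s hs => by simpa using sign_eq_neg_one_iff.1 (hgt s hs))
      rw [eval_neg, eval_neg, Left.sign_neg, Left.sign_neg, neg_inj] at hs
      exact ⟨v, hv, hs⟩
    · rw [sign_pos h0] at hft hgt
      exact h.exists_sign_eq_of_pos hg hpt hF hG (fun s hs => sign_eq_one_iff.1 (hft s hs))
        (fun s hs => sign_eq_one_iff.1 (hgt s hs))
  · exact ⟨u, refineCells_eq_iff.2 ⟨hu, by rw [hder t u hu, hpt t u hu hF]⟩⟩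

/-- On an open cell the factor `sign f'` makes the second label increase whether `f` rises or falls;
a point cell is not subdivided. -/
theorem monotone_refineCells (h : CellMatching c d) (hf : 0 < f.natDegree)
    (hder : ∀ t u, c t = d u →
      SignType.sign (f.derivative.eval t) = SignType.sign (g.derivative.eval u)) :
    Monotone (refineCells c f) := by
  intro s t hst
  rw [refineCells, refineCells, Prod.Lex.toLex_le_toLex]
  rcases (h.mono_left hst).lt_or_eq with hlt | heq
  · exact .inl hlt
  refine .inr ⟨heq, ?_⟩
  obtain ⟨u, hu⟩ := h.exists_right t
  rcases h.dichotomy t u hu with ⟨hF, -⟩ | ⟨hF, -⟩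
  · have hft : ∀ s, c s = c t →
        SignType.sign (f.derivative.eval s) = SignType.sign (f.derivative.eval t) :=
      fun s hs => (hder s u (hs.trans hu)).trans (hder t u hu).symm
    change SignType.sign _ * _ ≤ SignType.sign _ * _
    rw [hft s heq]
    rcases lt_or_gt_of_ne (h.derivative_ne_zero_of_isOpen hf hder hF) with h0 | h0
    · rw [sign_neg h0] at hft ⊢
      have := (strictMonoOn_eval_of_derivative_pos (f := -f) (h.ordConnected_left (c t))
        (fun s hs => by simpa using sign_eq_neg_one_iff.1 (hft s hs))).monotoneOn heq rfl hst
      simp only [eval_neg] at this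
      simpa [← Left.sign_neg] using SignType.sign.monotone this
    · rw [sign_pos h0] at hft ⊢
      have := (strictMonoOn_eval_of_derivative_pos (h.ordConnected_left (c t))
        (fun s hs => sign_eq_one_iff.1 (hft s hs))).monotoneOn heq rfl hst
      simpa using SignType.sign.monotone this
  · have : s ∈ c ⁻¹' {c t} := heq
    rw [hF] at this
    rw [mem_singleton_iff.1 this]

/-- On an open cell `f` is injective, so its zero there is isolated as a cell, while the parts `f >
0` and `f < 0` are open. -/
theorem refineCells_fiber (h : CellMatching c d) (hf : 0 < f.natDegree)
    (hder : ∀ t u, c t = d u →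
      SignType.sign (f.derivative.eval t) = SignType.sign (g.derivative.eval u))
    {t : ℝ} (hF : IsOpen (c ⁻¹' {c t})) :
    (f.eval t = 0 → refineCells c f ⁻¹' {refineCells c f t} = {t}) ∧
      (f.eval t ≠ 0 → IsOpen (refineCells c f ⁻¹' {refineCells c f t})) := by
  obtain ⟨u, hu⟩ := h.exists_right t
  have hft : ∀ s, c s = c t →
      SignType.sign (f.derivative.eval s) = SignType.sign (f.derivative.eval t) :=
    fun s hs => (hder s u (hs.trans hu)).trans (hder t u hu).symm
  have hne := sign_ne_zero.2 (h.derivative_ne_zero_of_isOpen hf hder hF)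
  have hfib : refineCells c f ⁻¹' {refineCells c f t} =
      c ⁻¹' {c t} ∩ {s | SignType.sign (f.eval s) = SignType.sign (f.eval t)} := by
    ext s
    rw [mem_preimage, mem_singleton_iff, refineCells_eq_iff]
    refine and_congr_right fun hs => ?_
    rw [hft s hs]
    exact mul_right_inj' hne
  have hinj : InjOn (fun s => f.eval s) (c ⁻¹' {c t}) := by
    rcases lt_or_gt_of_ne (h.derivative_ne_zero_of_isOpen hf hder hF) with h0 | h0
    · rw [sign_neg h0] at hft
      have := (strictMonoOn_eval_of_derivative_pos (f := -f) (h.ordConnected_left (c t))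
        (fun s hs => by simpa using sign_eq_neg_one_iff.1 (hft s hs))).injOn
      intro a ha b hb hab
      exact this ha hb (by simpa using hab)
    · rw [sign_pos h0] at hft
      exact (strictMonoOn_eval_of_derivative_pos (h.ordConnected_left (c t))
        (fun s hs => sign_eq_one_iff.1 (hft s hs))).injOn
  rw [hfib]
  refine ⟨fun h0 => ?_, fun h0 => hF.inter ?_⟩
  · ext s
    constructor
    · rintro ⟨hs, hs'⟩
      rw [mem_ofPred_eq, h0, sign_zero, sign_eq_zero_iff] at hs'
      exact hinj hs rfl (hs'.trans h0.symm)
    · rintro rfl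
      exact ⟨rfl, rfl⟩
  · rcases lt_or_gt_of_ne h0 with h0 | h0
    · simp only [sign_neg h0, sign_eq_neg_one_iff]
      exact isOpen_lt f.continuous continuous_const
    · simp only [sign_pos h0, sign_eq_one_iff]
      exact isOpen_lt continuous_const f.continuous

theorem sign_eq_of_refineCells_eq (h : CellMatching c d) (hf : 0 < f.natDegree)
    (hder : ∀ t u, c t = d u →
      SignType.sign (f.derivative.eval t) = SignType.sign (g.derivative.eval u))
    (hpt : ∀ t u, c t = d u → c ⁻¹' {c t} = {t} →
      SignType.sign (f.eval t) = SignType.sign (g.eval u)) {t u : ℝ}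
    (e : refineCells c f t = refineCells d g u) :
    SignType.sign (f.eval t) = SignType.sign (g.eval u) := by
  obtain ⟨e₁, e₂⟩ := refineCells_eq_iff.1 e
  rcases h.dichotomy t u e₁ with ⟨hF, -⟩ | ⟨hF, -⟩
  · rw [← hder t u e₁] at e₂
    exact mul_left_cancel₀ (sign_ne_zero.2 (h.derivative_ne_zero_of_isOpen hf hder hF)) e₂
  · exact hpt t u e₁ hF

/-- A matching of cells on which the derivatives of `f` and `g` have equal signs can be refined
by the zeros of `f` and `g`. -/
theorem refine (h : CellMatching c d) (hf : 0 < f.natDegree) (hg : 0 < g.natDegree)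
    (hder : ∀ t u, c t = d u →
      SignType.sign (f.derivative.eval t) = SignType.sign (g.derivative.eval u))
    (hpt : ∀ t u, c t = d u → c ⁻¹' {c t} = {t} →
      SignType.sign (f.eval t) = SignType.sign (g.eval u)) :
    CellMatching (refineCells c f) (refineCells d g) := by
  have hder' : ∀ t u, d t = c u →
      SignType.sign (g.derivative.eval t) = SignType.sign (f.derivative.eval u) :=
    fun t u e => (hder u t e.symm).symm
  -- A singleton of the line is not open, so the match of a point cell is a point cell.
  have hpt' : ∀ t u, d t = c u → d ⁻¹' {d t} = {t} →
      SignType.sign (g.eval t) = SignType.sign (f.eval u) := by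
    intro t u e he
    rcases h.dichotomy u t e.symm with ⟨-, ho⟩ | ⟨h₁, -⟩
    · rw [← e, he] at ho
      exact absurd ho (not_isOpen_singleton t)
    · exact (hpt u t e.symm h₁).symm
  refine ⟨h.monotone_refineCells hf hder, h.symm.monotone_refineCells hg hder', ?_, ?_⟩
  · apply Subset.antisymm
    · rintro _ ⟨t, rfl⟩
      obtain ⟨u, hu⟩ := h.exists_refineCells_eq hf hg hder hpt t
      exact ⟨u, hu.symm⟩
    · rintro _ ⟨t, rfl⟩
      obtain ⟨u, hu⟩ := h.symm.exists_refineCells_eq hg hf hder' hpt' t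
      exact ⟨u, hu.symm⟩
  · intro t u e
    have hs := h.sign_eq_of_refineCells_eq hf hder hpt e
    have e₁ := (refineCells_eq_iff.1 e).1
    rcases h.dichotomy t u e₁ with ⟨hF, hG⟩ | ⟨hF, hG⟩
    · rw [e₁] at hG
      have hF' := h.refineCells_fiber hf hder hF
      have hG' := h.symm.refineCells_fiber hg hder' hG
      rw [← e] at hG'
      by_cases h0 : f.eval t = 0
      · rw [h0, sign_zero, eq_comm, sign_eq_zero_iff] at hs
        exact .inr ⟨hF'.1 h0, hG'.1 hs⟩
      · exact .inl ⟨hF'.2 h0, hG'.2 (by rwa [← sign_ne_zero, ← hs, sign_ne_zero])⟩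
    · refine .inr ⟨?_, ?_⟩
      · refine Subset.antisymm (fun s hs => ?_) (by rintro _ rfl; rfl)
        rw [← hF]
        exact (refineCells_eq_iff.1 hs).1
      · refine Subset.antisymm (fun s hs => ?_) (by rintro _ rfl; exact e.symm)
        rw [← hG]
        exact (refineCells_eq_iff.1 ((mem_singleton_iff.1 hs).trans e)).1.trans e₁.symm

/-- Serves to keep every point cell a root of some polynomial of the family. -/
theorem of_refineCells_fiber_eq_singleton (h : CellMatching c d) (hf : 0 < f.natDegree)
    (hder : ∀ t u, c t = d u →
      SignType.sign (f.derivative.eval t) = SignType.sign (g.derivative.eval u)) {t : ℝ}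
    (ht : refineCells c f ⁻¹' {refineCells c f t} = {t}) :
    c ⁻¹' {c t} = {t} ∨ f.eval t = 0 := by
  obtain ⟨u, hu⟩ := h.exists_right t
  rcases h.dichotomy t u hu with ⟨hF, -⟩ | ⟨hF, -⟩
  · right
    by_contra h0
    have := (h.refineCells_fiber hf hder hF).2 h0
    rw [ht] at this
    exact not_isOpen_singleton t this
  · exact .inl hF

end CellMatching

/-! ### Elimination of real quantifiers -/

open Polynomial

section Elimination

variable {A : Type*} [CommRing A]

theorem exists_pseudo_division (q : A[X]) (hq : 0 < q.natDegree) (n : ℕ) :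
    ∀ p : A[X], p.natDegree < n → ∃ (r s : A[X]) (k : ℕ), r.natDegree < q.natDegree ∧
      C q.leadingCoeff ^ k * p = s * q + r := by
  induction n with
  | zero => exact fun p hp => absurd hp (Nat.not_lt_zero _)
  | succ n ih =>
    intro p hp
    rcases lt_or_ge p.natDegree q.natDegree with hlt | hge
    · exact ⟨p, 0, 0, hlt, by simp⟩
    set m := C p.leadingCoeff * X ^ (p.natDegree - q.natDegree) with hm
    -- The top terms cancel. The bound is a true drop in degree because `p.natDegree ≥ q.natDegree >
    -- 0`.
    have hdeg : (C q.leadingCoeff * p - m * q).natDegree ≤ p.natDegree - 1 := by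
      refine natDegree_le_pred ((natDegree_sub_le_of_le (natDegree_C_mul_le _ _) ?_).trans
        (max_self _).le) ?_
      · refine natDegree_mul_le.trans ?_
        have := natDegree_C_mul_X_pow_le p.leadingCoeff (p.natDegree - q.natDegree)
        rw [← hm] at this
        omega
      · have hcoeff : (m * q).coeff p.natDegree = p.leadingCoeff * q.leadingCoeff := by
          rw [hm, mul_assoc, coeff_C_mul, coeff_X_pow_mul', if_pos (Nat.sub_le _ _),
            Nat.sub_sub_self hge]
          rfl
        rw [coeff_sub, coeff_C_mul, hcoeff, coeff_natDegree, mul_comm, sub_self]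
    obtain ⟨r, s, k, hr, e⟩ := ih _ (hdeg.trans_lt (by omega))
    refine ⟨r, s + C q.leadingCoeff ^ k * m, k + 1, hr, ?_⟩
    rw [pow_succ]
    linear_combination e

/-- A square factor is positive wherever the leading coefficient is nonzero, so at roots of `q` the
remainder has the sign of `p`. -/
theorem exists_even_pseudo_division (p q : A[X]) (hq : 0 < q.natDegree) :
    ∃ (r s : A[X]) (k : ℕ), r.natDegree < q.natDegree ∧
      C (q.leadingCoeff ^ k * q.leadingCoeff ^ k) * p = s * q + r := by
  obtain ⟨r, s, k, hr, e⟩ := exists_pseudo_division q hq _ p (Nat.lt_succ_self _)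
  refine ⟨C (q.leadingCoeff ^ k) * r, C (q.leadingCoeff ^ k) * s, k,
    (natDegree_C_mul_le _ _).trans_lt hr, ?_⟩
  rw [C_mul, C_pow]
  linear_combination C q.leadingCoeff ^ k * e

/-- A pseudo-remainder of `p` by `q`, where `p` is multiplied by an even power of the leading
coefficient of `q`. -/
noncomputable def pseudoRem (p q : A[X]) : A[X] :=
  open Classical in
  if hq : 0 < q.natDegree then (exists_even_pseudo_division p q hq).choose else 0

theorem natDegree_pseudoRem_lt (p : A[X]) {q : A[X]} (hq : 0 < q.natDegree) :
    (pseudoRem p q).natDegree < q.natDegree := by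
  rw [pseudoRem, dif_pos hq]
  exact (exists_even_pseudo_division p q hq).choose_spec.choose_spec.choose_spec.1

theorem sign_eval_pseudoRem (x : A →+* ℝ) (p : A[X]) {q : A[X]} (hq : 0 < q.natDegree)
    (hlc : x q.leadingCoeff ≠ 0) {t : ℝ} (ht : (q.map x).eval t = 0) :
    SignType.sign ((p.map x).eval t) = SignType.sign (((pseudoRem p q).map x).eval t) := by
  rw [pseudoRem, dif_pos hq]
  obtain ⟨k, -, e⟩ := (exists_even_pseudo_division p q hq).choose_spec.choose_spec
  have := congrArg (fun f : A[X] => (f.map x).eval t) e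
  simp only [Polynomial.map_mul, Polynomial.map_add, map_C, eval_mul, eval_add, eval_C, ht,
    mul_zero, zero_add] at this
  rw [map_mul x, map_pow] at this
  rw [← this, sign_mul, sign_pos (mul_self_pos.2 (pow_ne_zero k hlc)), one_mul]

/-- The elements of degree at least `k` of a finite set of polynomials have their derivatives,
truncations and mutual pseudo-remainders in this set. -/
def IsSignClosed (k : ℕ) (S : Finset A[X]) : Prop :=
  ∀ p ∈ S, k ≤ p.natDegree → derivative p ∈ S ∧ p.eraseLead ∈ S ∧
    ∀ q ∈ S, k ≤ q.natDegree → q.natDegree ≤ p.natDegree → pseudoRem p q ∈ S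

/-- Only operations involving an element of degree exactly `k` can be missing. Their results have
degree below `k`, so they create no new obligation at level `k`. -/
theorem IsSignClosed.exists_superset {k : ℕ} (hk : 0 < k) {S : Finset A[X]}
    (hS : IsSignClosed (k + 1) S) : ∃ S', S ⊆ S' ∧ IsSignClosed k S' := by
  classical
  let R : Finset A[X] := (S.image derivative ∪ S.image eraseLead ∪
    (S ×ˢ S).image fun a => pseudoRem a.1 a.2).filter fun r => r.natDegree < k
  have hmem : ∀ p ∈ S ∪ R, k ≤ p.natDegree → p ∈ S := by
    intro p hp hkp
    rcases Finset.mem_union.1 hp with h | h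
    · exact h
    · exact absurd (Finset.mem_filter.1 h).2 (not_lt.2 hkp)
  refine ⟨S ∪ R, Finset.subset_union_left, fun p hp hkp => ?_⟩
  have hpS := hmem p hp hkp
  refine ⟨?_, ?_, fun q hq hkq hqp => ?_⟩
  · rcases hkp.lt_or_eq with hlt | heq
    · exact Finset.mem_union_left _ (hS p hpS hlt).1
    · refine Finset.mem_union_right _ (Finset.mem_filter.2 ⟨?_, ?_⟩)
      · simp only [Finset.mem_union]
        exact .inl (.inl (Finset.mem_image_of_mem _ hpS))
      · exact heq ▸ natDegree_derivative_lt (by omega)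
  · rcases hkp.lt_or_eq with hlt | heq
    · exact Finset.mem_union_left _ (hS p hpS hlt).2.1
    · refine Finset.mem_union_right _ (Finset.mem_filter.2 ⟨?_, ?_⟩)
      · simp only [Finset.mem_union]
        exact .inl (.inr (Finset.mem_image_of_mem _ hpS))
      · have := eraseLead_natDegree_le p
        omega
  · have hqS := hmem q hq hkq
    rcases hkq.lt_or_eq with hlt | heq
    · exact Finset.mem_union_left _ ((hS p hpS (hlt.trans_le hqp)).2.2 q hqS hlt hqp)
    · refine Finset.mem_union_right _ (Finset.mem_filter.2 ⟨?_, ?_⟩)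
      · simp only [Finset.mem_union]
        exact .inr (Finset.mem_image.2 ⟨(p, q), Finset.mem_product.2 ⟨hpS, hqS⟩, rfl⟩)
      · exact (natDegree_pseudoRem_lt p (by omega)).trans_eq heq.symm

theorem exists_isSignClosed_superset (S : Finset A[X]) :
    ∃ S', S ⊆ S' ∧ IsSignClosed 1 S' := by
  refine Nat.decreasingInduction (n := S.sup natDegree)
    (motive := fun k _ => ∃ S', S ⊆ S' ∧ IsSignClosed (k + 1) S') ?_ ?_ (Nat.zero_le _)
  · rintro k - ⟨S', h, hc⟩
    obtain ⟨S'', h', hc'⟩ := hc.exists_superset k.succ_pos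
    exact ⟨S'', h.trans h', hc'⟩
  · exact ⟨S, subset_rfl, fun p hp hlt =>
      absurd (Finset.le_sup (f := natDegree) hp) (not_le.2 hlt)⟩

theorem eval_map_eraseLead (x : A →+* ℝ) {p : A[X]} (hp : x p.leadingCoeff = 0) (t : ℝ) :
    (p.eraseLead.map x).eval t = (p.map x).eval t := by
  conv_rhs => rw [← eraseLead_add_C_mul_X_pow p]
  rw [Polynomial.map_add, Polynomial.map_mul, map_C, hp, C_0, zero_mul, add_zero]

theorem eval_map_of_natDegree_eq_zero (x : A →+* ℝ) {p : A[X]} (hp : p.natDegree = 0) (t : ℝ) :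
    (p.map x).eval t = x p.leadingCoeff := by
  rw [leadingCoeff, hp]
  conv_lhs => rw [eq_C_of_natDegree_eq_zero hp]
  simp

/-- If two real points of `A` agree in the signs of the leading coefficients of a closed finite
set of polynomials over `A`, the real lines over these points have matching cell decompositions
adapted to these polynomials. -/
theorem IsSignClosed.exists_cellMatching {S : Finset A[X]} (hS : IsSignClosed 1 S)
    {x y : A →+* ℝ}
    (hxy : ∀ p ∈ S, SignType.sign (x p.leadingCoeff) = SignType.sign (y p.leadingCoeff))
    (T : Finset A[X]) (hTS : T ⊆ S)
    (hT : ∀ p ∈ T, ∀ q ∈ S, q.natDegree < p.natDegree → q ∈ T) :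
    ∃ (I : Type) (_ : LinearOrder I) (c d : ℝ → I), CellMatching c d ∧
      (∀ t u, c t = d u → ∀ p ∈ T,
        SignType.sign ((p.map x).eval t) = SignType.sign ((p.map y).eval u)) ∧
      ∀ t, c ⁻¹' {c t} = {t} → ∃ q ∈ T, x q.leadingCoeff ≠ 0 ∧ (q.map x).eval t = 0 := by
  classical
  induction T using Finset.strongInduction with
  | H T ih =>
  rcases T.eq_empty_or_nonempty with rfl | hne
  · refine ⟨Unit, inferInstance, fun _ => (), fun _ => (), ⟨fun _ _ _ => le_rfl,
      fun _ _ _ => le_rfl, rfl, fun _ _ _ => .inl ⟨by simp, by simp⟩⟩, by simp, fun t ht => ?_⟩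
    have : t + 1 ∈ (fun _ : ℝ => ()) ⁻¹' {()} := rfl
    rw [ht] at this
    simp at this
  -- Removing an element of maximal degree keeps the family closed downwards in degree.
  obtain ⟨p, hpT, hpmax⟩ := T.exists_max_image natDegree hne
  have hlow : ∀ q ∈ S, q.natDegree < p.natDegree → q ∈ T.erase p := fun q hq hlt =>
    Finset.mem_erase.2 ⟨fun h => (h ▸ hlt).ne rfl, hT p hpT q hq hlt⟩
  obtain ⟨I, _, c, d, h, hsign, hroot⟩ := ih (T.erase p) (Finset.erase_ssubset hpT)
    ((Finset.erase_subset _ _).trans hTS) fun a ha q hq hlt =>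
      hlow q hq (hlt.trans_le (hpmax a (Finset.mem_of_mem_erase ha)))
  have hroot' : ∀ t, c ⁻¹' {c t} = {t} → ∃ q ∈ T, x q.leadingCoeff ≠ 0 ∧
      (q.map x).eval t = 0 := fun t ht => by
    obtain ⟨q, hq, hq'⟩ := hroot t ht
    exact ⟨q, Finset.mem_of_mem_erase hq, hq'⟩
  have hplc := hxy p (hTS hpT)
  by_cases heasy : ∀ t u, c t = d u →
      SignType.sign ((p.map x).eval t) = SignType.sign ((p.map y).eval u)
  · refine ⟨I, inferInstance, c, d, h, fun t u e q hq => ?_, hroot'⟩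
    by_cases hqp : q = p
    · exact hqp ▸ heasy t u e
    · exact hsign t u e q (Finset.mem_erase.2 ⟨hqp, hq⟩)
  have hp0 : 0 < p.natDegree := by
    refine Nat.pos_of_ne_zero fun h0 => heasy fun t u _ => ?_
    rw [eval_map_of_natDegree_eq_zero x h0, eval_map_of_natDegree_eq_zero y h0, hplc]
  obtain ⟨hder, herase, hrem⟩ := hS p (hTS hpT) hp0
  -- If the leading coefficient vanished, `p` could be replaced by its truncation, whose signs
  -- already match.
  have hx : x p.leadingCoeff ≠ 0 := by
    intro h0
    have h0' : y p.leadingCoeff = 0 := by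
      rwa [h0, sign_zero, eq_comm, sign_eq_zero_iff] at hplc
    refine heasy fun t u e => ?_
    rw [← eval_map_eraseLead x h0, ← eval_map_eraseLead y h0']
    refine hsign t u e _ (hlow _ herase ?_)
    have := eraseLead_natDegree_le p
    omega
  have hy : y p.leadingCoeff ≠ 0 := by
    rwa [← sign_ne_zero, ← hplc, sign_ne_zero]
  have hfx : 0 < (p.map x).natDegree := by
    rwa [natDegree_map_of_leadingCoeff_ne_zero x hx]
  have hfy : 0 < (p.map y).natDegree := by
    rwa [natDegree_map_of_leadingCoeff_ne_zero y hy]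
  have hd : ∀ t u, c t = d u → SignType.sign ((p.map x).derivative.eval t) =
      SignType.sign ((p.map y).derivative.eval u) := fun t u e => by
    rw [derivative_map, derivative_map]
    exact hsign t u e _ (hlow _ hder (natDegree_derivative_lt hp0.ne'))
  have hpt : ∀ t u, c t = d u → c ⁻¹' {c t} = {t} →
      SignType.sign ((p.map x).eval t) = SignType.sign ((p.map y).eval u) := by
    intro t u e he
    obtain ⟨q, hq, hlc, hqt⟩ := hroot t he
    have hqS := hTS (Finset.mem_of_mem_erase hq)
    have hq0 : 0 < q.natDegree := by
      refine Nat.pos_of_ne_zero fun h0 => hlc ?_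
      rwa [eval_map_of_natDegree_eq_zero x h0] at hqt
    have hqp := hpmax q (Finset.mem_of_mem_erase hq)
    have hqu := hsign t u e q hq
    rw [hqt, sign_zero, eq_comm, sign_eq_zero_iff] at hqu
    have hlc' : y q.leadingCoeff ≠ 0 := by
      rwa [← sign_ne_zero, ← hxy q hqS, sign_ne_zero]
    -- Both points are roots of the same `q`, so the signs of `p` are those of a remainder of
    -- smaller degree.
    rw [sign_eval_pseudoRem x p hq0 hlc hqt, sign_eval_pseudoRem y p hq0 hlc' hqu]
    exact hsign t u e _ (hlow _ (hrem q hqS hq0 hqp)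
      ((natDegree_pseudoRem_lt p hq0).trans_le hqp))
  refine ⟨I ×ₗ SignType, inferInstance, refineCells c (p.map x), refineCells d (p.map y),
    h.refine hfx hfy hd hpt, fun t u e q hq => ?_, fun t ht => ?_⟩
  · by_cases hqp : q = p
    · exact hqp ▸ h.sign_eq_of_refineCells_eq hfx hd hpt e
    · exact hsign t u (refineCells_eq_iff.1 e).1 q (Finset.mem_erase.2 ⟨hqp, hq⟩)
  · rcases h.of_refineCells_fiber_eq_singleton hfx hd ht with h1 | h1
    · exact hroot' t h1
    · exact ⟨p, hpT, hx, h1⟩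

/-- The leading coefficients of a sign-closed family containing `P` suffice. -/
theorem exists_finset_sign_eval (P : Finset A[X]) : ∃ A₀ : Finset A, ∀ x y : A →+* ℝ,
    (∀ a ∈ A₀, SignType.sign (x a) = SignType.sign (y a)) → ∀ t, ∃ u, ∀ p ∈ P,
      SignType.sign ((p.map x).eval t) = SignType.sign ((p.map y).eval u) := by
  classical
  obtain ⟨S, hPS, hS⟩ := exists_isSignClosed_superset P
  refine ⟨S.image leadingCoeff, fun x y hxy t => ?_⟩
  obtain ⟨I, _, c, d, h, hsign, -⟩ := hS.exists_cellMatching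
    (fun p hp => hxy _ (Finset.mem_image_of_mem _ hp)) S subset_rfl fun _ _ q hq _ => hq
  obtain ⟨u, hu⟩ := h.exists_right t
  exact ⟨u, fun p hp => hsign t u hu p (hPS hp)⟩

/-- The sign conditions on finitely many polynomials that are realised over a real point of `A`
depend only on the signs of finitely many elements of `A` at this point. -/
theorem exists_finset_sign_eval₂_fin (k : ℕ) : ∀ P : Finset (MvPolynomial (Fin k) A),
    ∃ A₀ : Finset A, ∀ x y : A →+* ℝ,
      (∀ a ∈ A₀, SignType.sign (x a) = SignType.sign (y a)) → ∀ v : Fin k → ℝ, ∃ w : Fin k → ℝ,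
        ∀ p ∈ P, SignType.sign (p.eval₂ x v) = SignType.sign (p.eval₂ y w) := by
  classical
  induction k with
  | zero =>
    intro P
    refine ⟨P.image (MvPolynomial.coeff 0), fun x y hxy v => ⟨v, fun p hp => ?_⟩⟩
    rw [MvPolynomial.eq_C_of_isEmpty p, MvPolynomial.eval₂_C, MvPolynomial.eval₂_C]
    exact hxy _ (Finset.mem_image_of_mem _ hp)
  | succ k ih =>
    intro P
    -- The first variable is eliminated over the polynomial ring in the other `k`.
    obtain ⟨B₀, hB⟩ := exists_finset_sign_eval (P.image (MvPolynomial.finSuccEquiv A k))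
    obtain ⟨A₀, hA⟩ := ih B₀
    refine ⟨A₀, fun x y hxy v => ?_⟩
    obtain ⟨w, hw⟩ := hA x y hxy (Fin.tail v)
    obtain ⟨u, hu⟩ := hB (MvPolynomial.eval₂Hom x (Fin.tail v)) (MvPolynomial.eval₂Hom y w) hw (v 0)
    have key : ∀ (z : A →+* ℝ) (s : ℝ) (r : Fin k → ℝ) (p : MvPolynomial (Fin (k + 1)) A),
        ((MvPolynomial.finSuccEquiv A k p).map (MvPolynomial.eval₂Hom z r)).eval s =
          p.eval₂ z (Fin.cons s r : Fin (k + 1) → ℝ) := by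
      intro z s r p
      induction p using MvPolynomial.induction_on with
      | C a => simp [MvPolynomial.finSuccEquiv_apply]
      | add p q hp hq => simp [hp, hq, MvPolynomial.eval₂_add]
      | mul_X p i hp =>
        rw [map_mul, Polynomial.map_mul, eval_mul, hp, MvPolynomial.eval₂_mul,
          MvPolynomial.eval₂_X]
        congr 1
        refine Fin.cases ?_ (fun j => ?_) i
        · simp [MvPolynomial.finSuccEquiv_X_zero]
        · simp [MvPolynomial.finSuccEquiv_X_succ]
    refine ⟨Fin.cons u w, fun p hp => ?_⟩
    have := hu _ (Finset.mem_image_of_mem _ hp)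
    rwa [key, key, Fin.cons_self_tail] at this

theorem exists_finset_sign_eval₂ {κ : Type*} [Finite κ] (P : Finset (MvPolynomial κ A)) :
    ∃ A₀ : Finset A, ∀ x y : A →+* ℝ,
      (∀ a ∈ A₀, SignType.sign (x a) = SignType.sign (y a)) → ∀ v : κ → ℝ, ∃ w : κ → ℝ,
        ∀ p ∈ P, SignType.sign (p.eval₂ x v) = SignType.sign (p.eval₂ y w) := by
  classical
  obtain ⟨k, ⟨e⟩⟩ := Finite.exists_equiv_fin κ
  obtain ⟨A₀, hA⟩ := exists_finset_sign_eval₂_fin k (P.image (MvPolynomial.rename e))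
  refine ⟨A₀, fun x y hxy v => ?_⟩
  obtain ⟨w, hw⟩ := hA x y hxy (v ∘ e.symm)
  refine ⟨w ∘ e, fun p hp => ?_⟩
  have := hw _ (Finset.mem_image_of_mem _ hp)
  rwa [MvPolynomial.eval₂_rename, MvPolynomial.eval₂_rename, Function.comp_assoc,
    e.symm_comp_self, Function.comp_id] at this

end Elimination

/-- A set of real points that depends only on the signs of finitely many polynomials is
semialgebraic. -/
theorem isSemialgebraicCoord_of_sign {m : ℕ} {S : Set (Fin m → ℝ)}
    (A₀ : Finset (MvPolynomial (Fin m) ℝ))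
    (h : ∀ x y, (∀ a ∈ A₀, SignType.sign (MvPolynomial.eval x a) =
      SignType.sign (MvPolynomial.eval y a)) → x ∈ S → y ∈ S) : IsSemialgebraicCoord S := by
  classical
  let σ : (Fin m → ℝ) → A₀ → SignType := fun x a => SignType.sign (MvPolynomial.eval x a.1)
  -- One basic set for each of the finitely many sign vectors realised on `S`.
  let J := {s : A₀ → SignType // s ∈ σ '' S}
  let e : J ≃ Fin (Fintype.card J) := Fintype.equivFin J
  let Z : J → Finset (MvPolynomial (Fin m) ℝ) := fun s =>
    (Finset.univ.filter fun a : A₀ => s.1 a = 0).image Subtype.val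
  let Q : J → Finset (MvPolynomial (Fin m) ℝ) := fun s =>
    (Finset.univ.filter fun a : A₀ => s.1 a = 1).image Subtype.val ∪
      (Finset.univ.filter fun a : A₀ => s.1 a = -1).image fun a => -a.1
  have hcell : ∀ (s : J) x, ((∀ p ∈ Z s, MvPolynomial.eval x p = 0) ∧
      ∀ q ∈ Q s, 0 < MvPolynomial.eval x q) ↔ σ x = s.1 := by
    intro s x
    constructor
    · rintro ⟨hZ, hQ⟩
      funext a
      rcases hs : s.1 a with _ | _ | _
      · refine sign_eq_zero_iff.2 (hZ _ (Finset.mem_image.2 ⟨a, ?_, rfl⟩))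
        simpa using hs
      · refine sign_eq_neg_one_iff.2 ?_
        have := hQ (-a.1) (Finset.mem_union_right _ (Finset.mem_image.2 ⟨a, by simpa using hs, rfl⟩))
        simpa using this
      · refine sign_eq_one_iff.2 ?_
        exact hQ a.1 (Finset.mem_union_left _ (Finset.mem_image.2 ⟨a, by simpa using hs, rfl⟩))
    · intro hs
      refine ⟨fun p hp => ?_, fun q hq => ?_⟩
      · obtain ⟨a, ha, rfl⟩ := Finset.mem_image.1 hp
        exact sign_eq_zero_iff.1 ((congrFun hs a).trans (Finset.mem_filter.1 ha).2)
      · rcases Finset.mem_union.1 hq with hq | hq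
        · obtain ⟨a, ha, rfl⟩ := Finset.mem_image.1 hq
          exact sign_eq_one_iff.1 ((congrFun hs a).trans (Finset.mem_filter.1 ha).2)
        · obtain ⟨a, ha, rfl⟩ := Finset.mem_image.1 hq
          rw [map_neg, neg_pos]
          exact sign_eq_neg_one_iff.1 ((congrFun hs a).trans (Finset.mem_filter.1 ha).2)
  refine ⟨Fintype.card J, fun i => Z (e.symm i), fun i => Q (e.symm i), ?_⟩
  ext x
  rw [Set.mem_iUnion]
  constructor
  · intro hx
    refine ⟨e ⟨σ x, x, hx, rfl⟩, (hcell _ x).2 ?_⟩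
    rw [Equiv.symm_apply_apply]
  · rintro ⟨i, hi⟩
    obtain ⟨z, hz, hzs⟩ := (e.symm i).2
    exact h z x (fun a ha => congrFun (hzs.trans ((hcell _ x).1 hi).symm) ⟨a, ha⟩) hz

/-! ### Symplectic bilinear forms -/

theorem eq_zero_of_map_basis_eq_zero {E F : Type*} [AddCommGroup E] [Module ℝ E]
    [AddCommGroup F] [Module ℝ F] {ι : Type*} [Finite ι] (b : Module.Basis ι ℝ E)
    {Ω : E [⋀^ι]→ₗ[ℝ] F} (h : Ω b = 0) : Ω = 0 := by
  classical
  refine Module.Basis.ext_alternating b fun i hi => ?_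
  let σ : Equiv.Perm ι := Equiv.ofBijective i (Finite.injective_iff_bijective.1 hi)
  cases nonempty_fintype ι
  change Ω (b ∘ σ) = 0
  rw [AlternatingMap.map_perm, h, smul_zero]

section Lagrangian

variable {V : Type*} [AddCommGroup V] [Module ℝ V]

theorem symplectic_swap (ω : V [⋀^Fin 2]→ₗ[ℝ] ℝ) (x y : V) : ω ![x, y] = -ω ![y, x] := by
  rw [← ω.map_swap ![y, x] (i := 0) (j := 1) (by decide)]
  congr 1
  ext i
  fin_cases i <;> rfl

/-- The bilinear form of an alternating `2`-form. -/
def toBilinForm (ω : V [⋀^Fin 2]→ₗ[ℝ] ℝ) : LinearMap.BilinForm ℝ V :=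
  LinearMap.mk₂ ℝ (fun x y => ω ![x, y])
    (fun x x' y => ω.map_vecCons_add ![y] x x') (fun c x y => ω.map_vecCons_smul ![y] c x)
    (fun x y y' => by
      rw [symplectic_swap ω x, symplectic_swap ω x y, symplectic_swap ω x y', ← neg_add]
      exact congrArg _ (ω.map_vecCons_add ![x] y y'))
    (fun c x y => by
      rw [symplectic_swap ω x, symplectic_swap ω x y, smul_neg]
      exact congrArg _ (ω.map_vecCons_smul ![x] c y))

@[simp]
theorem toBilinForm_apply (ω : V [⋀^Fin 2]→ₗ[ℝ] ℝ) (x y : V) :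
    toBilinForm ω x y = ω ![x, y] := rfl

theorem mem_orthogonal_toBilinForm {ω : V [⋀^Fin 2]→ₗ[ℝ] ℝ} {L : Submodule ℝ V} {x : V} :
    x ∈ (toBilinForm ω).orthogonal L ↔ ∀ y ∈ L, ω ![x, y] = 0 := by
  refine forall₂_congr fun y _ => ?_
  rw [symplectic_swap, neg_eq_zero]
  rfl

theorem isLagrangian_iff {ω : V [⋀^Fin 2]→ₗ[ℝ] ℝ} {L : Submodule ℝ V} :
    IsLagrangian ω L ↔ L = (toBilinForm ω).orthogonal L := by
  rw [SetLike.ext_iff]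
  exact forall_congr' fun x => by rw [mem_orthogonal_toBilinForm]

variable {n N : ℕ} {ω : V [⋀^Fin 2]→ₗ[ℝ] ℝ}

/-! ### Polynomial equations of frames -/

/-- The vectors with the given coordinates in a basis. -/
noncomputable def frame (β : Module.Basis (Fin N) ℝ V) (v : Fin n × Fin N → ℝ) (i : Fin n) : V :=
  ∑ l, v (i, l) • β l

theorem linearIndependent_frame (β : Module.Basis (Fin N) ℝ V) {v : Fin n × Fin N → ℝ}
    (hv : ∀ i j, ∑ l, v (i, l) * v (j, l) = if i = j then 1 else 0) :
    LinearIndependent ℝ (frame β v) := by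
  rw [Fintype.linearIndependent_iff]
  intro g hg j
  have hcoord : ∀ l, ∑ i, g i * v (i, l) = 0 := by
    intro l
    have := congrArg (fun x => β.repr x l) hg
    simpa [frame, Finsupp.single_apply] using this
  calc g j = ∑ i, g i * ∑ l, v (i, l) * v (j, l) := by simp [hv]
    _ = ∑ l, (∑ i, g i * v (i, l)) * v (j, l) := by
      simp_rw [Finset.mul_sum, Finset.sum_mul, mul_assoc]
      exact Finset.sum_comm
    _ = 0 := by simp [hcoord]

theorem symplectic_frame (β : Module.Basis (Fin N) ℝ V) (v : Fin n × Fin N → ℝ) (i j : Fin n) :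
    ω ![frame β v i, frame β v j] =
      ∑ l, ∑ k, v (i, l) * v (j, k) * ω ![β l, β k] := by
  rw [← toBilinForm_apply, frame, frame, LinearMap.BilinForm.sum_left]
  refine Finset.sum_congr rfl fun l _ => ?_
  rw [LinearMap.BilinForm.sum_right]
  refine Finset.sum_congr rfl fun k _ => ?_
  rw [LinearMap.BilinForm.smul_left, LinearMap.BilinForm.smul_right, toBilinForm_apply, mul_assoc]

theorem apply_frame (β : Module.Basis (Fin N) ℝ V) (v : Fin n × Fin N → ℝ)
    (Ω : V [⋀^Fin n]→ₗ[ℝ] ℂ) :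
    Ω (frame β v) = ∑ f : Fin n → Fin N, (∏ i, v (i, f i)) • Ω fun i => β (f i) := by
  have h := Ω.toMultilinearMap.map_sum fun i l => v (i, l) • β l
  simp only [MultilinearMap.map_smul_univ] at h
  exact h

variable {m : ℕ}

/-- The coefficients of the pullback of a form to a frame, as functionals of its coordinates. -/
noncomputable def coeffFunctional (e : primitiveForms ω n ≃ₗ[ℝ] (Fin m → ℝ)) (β : Module.Basis (Fin N) ℝ V)
    (r : ℂ →ₗ[ℝ] ℝ) (f : Fin n → Fin N) : (Fin m → ℝ) →ₗ[ℝ] ℝ where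
  toFun x := r ((e.symm x : V [⋀^Fin n]→ₗ[ℝ] ℂ) fun i => β (f i))
  map_add' x y := by simp
  map_smul' c x := by
    rw [map_smul, Submodule.coe_smul, AlternatingMap.smul_apply, map_smul, RingHom.id_apply]

theorem map_apply_frame (e : primitiveForms ω n ≃ₗ[ℝ] (Fin m → ℝ))
    (β : Module.Basis (Fin N) ℝ V) (r : ℂ →ₗ[ℝ] ℝ) (x : Fin m → ℝ) (v : Fin n × Fin N → ℝ) :
    r ((e.symm x : V [⋀^Fin n]→ₗ[ℝ] ℂ) (frame β v)) =
      ∑ f : Fin n → Fin N, (∏ i, v (i, f i)) * coeffFunctional e β r f x := by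
  rw [apply_frame, map_sum]
  simp only [map_smul, smul_eq_mul]
  rfl

/-- The linear polynomial of a linear functional. -/
noncomputable def linearPolynomial (r : (Fin m → ℝ) →ₗ[ℝ] ℝ) : MvPolynomial (Fin m) ℝ :=
  ∑ j, MvPolynomial.X j * MvPolynomial.C (r (Pi.single j 1))

theorem eval_linearPolynomial (r : (Fin m → ℝ) →ₗ[ℝ] ℝ) (x : Fin m → ℝ) :
    MvPolynomial.eval x (linearPolynomial r) = r x := by
  rw [LinearMap.pi_apply_eq_sum_univ r x, linearPolynomial, map_sum]
  refine Finset.sum_congr rfl fun j _ => ?_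
  rw [map_mul, MvPolynomial.eval_X, MvPolynomial.eval_C, smul_eq_mul]
  congr 2
  ext k
  simp [Pi.single_apply, eq_comm]

/-- The real and imaginary parts as linear functionals. -/
noncomputable def complexParts : Bool → ℂ →ₗ[ℝ] ℝ
  | false => Complex.reLm
  | true => Complex.imLm

theorem eq_zero_iff_complexParts (z : ℂ) : z = 0 ↔ ∀ b, complexParts b z = 0 := by
  rw [Bool.forall_bool, Complex.ext_iff]
  rfl

/-! ### Lagrangian subspaces and frames -/

variable [FiniteDimensional ℝ V]

theorem IsSymplecticForm.finrank_add_finrank_orthogonal (hω : IsSymplecticForm ω)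
    (L : Submodule ℝ V) :
    Module.finrank ℝ L + Module.finrank ℝ ((toBilinForm ω).orthogonal L) =
      Module.finrank ℝ V := by
  have hker : LinearMap.ker (toBilinForm ω) = ⊥ :=
    (Submodule.eq_bot_iff _).2 fun x hx => hω x fun y => LinearMap.congr_fun hx y
  have := LinearMap.BilinForm.finrank_add_finrank_orthogonal' (B := toBilinForm ω) L
  rwa [hker, inf_bot_eq, finrank_bot, add_zero] at this

theorem IsLagrangian.finrank_eq (hdim : Module.finrank ℝ V = 2 * n) (hω : IsSymplecticForm ω)
    {L : Submodule ℝ V} (hL : IsLagrangian ω L) : Module.finrank ℝ L = n := by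
  have := hω.finrank_add_finrank_orthogonal L
  rw [← isLagrangian_iff.1 hL] at this
  omega

/-- An isotropic span lies in its orthogonal complement, and both have dimension `n`. -/
theorem isLagrangian_span (hdim : Module.finrank ℝ V = 2 * n) (hω : IsSymplecticForm ω)
    {v : Fin n → V} (hv : LinearIndependent ℝ v) (hiso : ∀ i j, ω ![v i, v j] = 0) :
    IsLagrangian ω (Submodule.span ℝ (Set.range v)) := by
  rw [isLagrangian_iff]
  refine Submodule.eq_of_le_of_finrank_le (Submodule.span_le.2 ?_) ?_
  · rintro _ ⟨i, rfl⟩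
    refine mem_orthogonal_toBilinForm.2 fun y hy => ?_
    induction hy using Submodule.span_induction with
    | mem y hy =>
      obtain ⟨j, rfl⟩ := hy
      exact hiso i j
    | zero => exact map_zero (toBilinForm ω (v i))
    | add y z _ _ hy hz =>
      exact (map_add (toBilinForm ω (v i)) y z).trans (by simp [hy, hz])
    | smul c y _ hy => exact (map_smul (toBilinForm ω (v i)) c y).trans (by simp [hy])
  · have h := hω.finrank_add_finrank_orthogonal (Submodule.span ℝ (Set.range v))
    have h' := finrank_span_eq_card hv
    rw [Fintype.card_fin] at h'
    omega


/-- The coordinates carry `L` into Euclidean space, where it has an orthonormal basis. -/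
theorem exists_frame_mem (β : Module.Basis (Fin N) ℝ V) {L : Submodule ℝ V}
    (hL : Module.finrank ℝ L = n) : ∃ v : Fin n × Fin N → ℝ,
      (∀ i j, ∑ l, v (i, l) * v (j, l) = if i = j then 1 else 0) ∧ ∀ i, frame β v i ∈ L := by
  let φ : V ≃ₗ[ℝ] EuclideanSpace ℝ (Fin N) :=
    β.equivFun ≪≫ₗ (WithLp.linearEquiv 2 ℝ (Fin N → ℝ)).symm
  have hL' : Module.finrank ℝ (L.map (φ : V →ₗ[ℝ] EuclideanSpace ℝ (Fin N))) = n :=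
    (LinearEquiv.finrank_map_eq φ L).trans hL
  let b := (stdOrthonormalBasis ℝ (L.map (φ : V →ₗ[ℝ] EuclideanSpace ℝ (Fin N)))).reindex
    (finCongr hL')
  refine ⟨fun a => (b a.1 : EuclideanSpace ℝ (Fin N)) a.2, fun i j => ?_, fun i => ?_⟩
  · have := orthonormal_iff_ite.1 b.orthonormal j i
    rw [Submodule.coe_inner, PiLp.inner_apply] at this
    simpa [eq_comm] using this
  · obtain ⟨x, hx, hxb⟩ := (b i).2
    have hcoe : ∀ l, (b i : EuclideanSpace ℝ (Fin N)) l = β.equivFun x l := fun l => by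
      rw [← hxb]
      rfl
    simp only [frame, hcoe]
    rw [β.sum_equivFun]
    exact hx

/-! ### The complement of `𝒰(V)` as a projection -/

/-- An `n`-form on an `n`-dimensional space vanishes once it vanishes on one basis. Orthonormality
encodes independence by equations and bounds the frames. -/
theorem notMem_nonvanishingForms_iff (hdim : Module.finrank ℝ V = 2 * n)
    (hω : IsSymplecticForm ω) (β : Module.Basis (Fin N) ℝ V) (Ω : primitiveForms ω n) :
    Ω ∉ nonvanishingForms ω n ↔ ∃ v : Fin n × Fin N → ℝ,
      (∀ i j, ∑ l, v (i, l) * v (j, l) = if i = j then 1 else 0) ∧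
      (∀ i j, ω ![frame β v i, frame β v j] = 0) ∧
      (Ω : V [⋀^Fin n]→ₗ[ℝ] ℂ) (frame β v) = 0 := by
  constructor
  · intro h
    change ¬ ∀ L : Submodule ℝ V, _ at h
    push Not at h
    obtain ⟨L, hL, h0⟩ := h
    obtain ⟨v, hv, hvL⟩ := exists_frame_mem β (hL.finrank_eq hdim hω)
    refine ⟨v, hv, fun i j => (hL _).1 (hvL i) _ (hvL j), ?_⟩
    exact congrArg (fun f => f fun i => (⟨frame β v i, hvL i⟩ : L)) h0
  · rintro ⟨v, hv, hiso, h0⟩ h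
    have hli := linearIndependent_frame β hv
    refine h _ (isLagrangian_span hdim hω hli hiso)
      (eq_zero_of_map_basis_eq_zero (Module.Basis.span hli) ?_)
    rw [AlternatingMap.compLinearMap_apply]
    convert h0 using 2
    funext i
    exact congrArg Subtype.val (Module.Basis.span_apply hli i)

theorem notMem_image_nonvanishingForms_iff (hdim : Module.finrank ℝ V = 2 * n)
    (hω : IsSymplecticForm ω) (β : Module.Basis (Fin N) ℝ V)
    (e : primitiveForms ω n ≃ₗ[ℝ] (Fin m → ℝ)) (x : Fin m → ℝ) :
    x ∉ e '' nonvanishingForms ω n ↔ ∃ v : Fin n × Fin N → ℝ,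
      (∀ i j, ∑ l, v (i, l) * v (j, l) = if i = j then 1 else 0) ∧
      (∀ i j, ∑ l, ∑ k, v (i, l) * v (j, k) * ω ![β l, β k] = 0) ∧
      ∀ b, ∑ f : Fin n → Fin N, (∏ i, v (i, f i)) *
        coeffFunctional e β (complexParts b) f x = 0 := by
  have : x ∉ e '' nonvanishingForms ω n ↔ e.symm x ∉ nonvanishingForms ω n := by
    rw [LinearEquiv.image_eq_preimage_symm]
    rfl
  rw [this, notMem_nonvanishingForms_iff hdim hω β]
  simp_rw [eq_zero_iff_complexParts, map_apply_frame, symplectic_frame]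

theorem isOpen_image_nonvanishingForms (hdim : Module.finrank ℝ V = 2 * n)
    (hω : IsSymplecticForm ω) (β : Module.Basis (Fin N) ℝ V)
    (e : primitiveForms ω n ≃ₗ[ℝ] (Fin m → ℝ)) :
    IsOpen (e '' nonvanishingForms ω n) := by
  let K : Set (Fin n × Fin N → ℝ) := {v |
    (∀ i j, ∑ l, v (i, l) * v (j, l) = if i = j then 1 else 0) ∧
      ∀ i j, ∑ l, ∑ k, v (i, l) * v (j, k) * ω ![β l, β k] = 0}
  have hKc : IsClosed K := by
    simp only [K, Set.ofPred_and, Set.ofPred_forall]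
    exact (isClosed_iInter fun i => isClosed_iInter fun j =>
      isClosed_eq (by fun_prop) continuous_const).inter
      (isClosed_iInter fun i => isClosed_iInter fun j =>
        isClosed_eq (by fun_prop) continuous_const)
  have hK : IsCompact K := by
    refine (isCompact_Icc (a := fun _ => (-1 : ℝ)) (b := fun _ => (1 : ℝ))).of_isClosed_subset
      hKc fun v hv => ?_
    have habs : ∀ a, |v a| ≤ 1 := by
      rintro ⟨i, l⟩
      have h1 := hv.1 i i
      rw [if_pos rfl] at h1
      rw [abs_le_one_iff_mul_self_le_one, ← h1]
      exact Finset.single_le_sum (f := fun l => v (i, l) * v (i, l))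
        (fun l _ => mul_self_nonneg _) (Finset.mem_univ l)
    exact ⟨fun a => (abs_le.1 (habs a)).1, fun a => (abs_le.1 (habs a)).2⟩
  have : CompactSpace K := isCompact_iff_compactSpace.1 hK
  let Z : Set (K × (Fin m → ℝ)) := {a | ∀ b, ∑ f : Fin n → Fin N,
    (∏ i, a.1.1 (i, f i)) * coeffFunctional e β (complexParts b) f a.2 = 0}
  have hZ : IsClosed Z := by
    simp only [Z, Set.ofPred_forall]
    refine isClosed_iInter fun b => isClosed_eq ?_ continuous_const
    have : ∀ f, Continuous (coeffFunctional e β (complexParts b) f) := fun f =>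
      LinearMap.continuous_of_finiteDimensional _
    refine continuous_finsetSum _ fun f _ => Continuous.mul ?_ ((this f).comp continuous_snd)
    exact continuous_finsetProd _ fun i _ =>
      (continuous_apply (i, f i)).comp (continuous_subtype_val.comp continuous_fst)
  rw [← isClosed_compl_iff]
  -- The complement is the image of the closed incidence set under projection along the compact `K`.
  convert isClosedMap_snd_of_compactSpace Z hZ
  ext x
  rw [Set.mem_compl_iff, notMem_image_nonvanishingForms_iff hdim hω β]
  constructor
  · rintro ⟨v, h₁, h₂, h₃⟩
    exact ⟨(⟨v, h₁, h₂⟩, x), h₃, rfl⟩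
  · rintro ⟨⟨v, x⟩, h₃, rfl⟩
    exact ⟨v, v.2.1, v.2.2, h₃⟩

theorem isSemialgebraicCoord_image_nonvanishingForms (hdim : Module.finrank ℝ V = 2 * n)
    (hω : IsSymplecticForm ω) (β : Module.Basis (Fin N) ℝ V)
    (e : primitiveForms ω n ≃ₗ[ℝ] (Fin m → ℝ)) :
    IsSemialgebraicCoord (e '' nonvanishingForms ω n) := by
  classical
  let gram : Fin n × Fin n → MvPolynomial (Fin n × Fin N) (MvPolynomial (Fin m) ℝ) := fun a =>
    ∑ l, MvPolynomial.X (a.1, l) * MvPolynomial.X (a.2, l) - if a.1 = a.2 then 1 else 0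
  let iso : Fin n × Fin n → MvPolynomial (Fin n × Fin N) (MvPolynomial (Fin m) ℝ) := fun a =>
    ∑ l, ∑ k, MvPolynomial.X (a.1, l) * MvPolynomial.X (a.2, k) *
      MvPolynomial.C (MvPolynomial.C (ω ![β l, β k]))
  let van : Bool → MvPolynomial (Fin n × Fin N) (MvPolynomial (Fin m) ℝ) := fun b =>
    ∑ f : Fin n → Fin N, (∏ i, MvPolynomial.X (i, f i)) *
      MvPolynomial.C (linearPolynomial (coeffFunctional e β (complexParts b) f))
  have hgram : ∀ a x v, (gram a).eval₂ (MvPolynomial.eval x) v =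
      ∑ l, v (a.1, l) * v (a.2, l) - if a.1 = a.2 then 1 else 0 := by
    intro a x v
    rw [← MvPolynomial.coe_eval₂Hom]
    dsimp only [gram]
    split_ifs <;> simp
  have hiso : ∀ a x v, (iso a).eval₂ (MvPolynomial.eval x) v =
      ∑ l, ∑ k, v (a.1, l) * v (a.2, k) * ω ![β l, β k] := by
    intro a x v
    rw [← MvPolynomial.coe_eval₂Hom]
    simp [iso]
  have hvan : ∀ b x v, (van b).eval₂ (MvPolynomial.eval x) v =
      ∑ f : Fin n → Fin N, (∏ i, v (i, f i)) *
        coeffFunctional e β (complexParts b) f x := by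
    intro b x v
    rw [← MvPolynomial.coe_eval₂Hom]
    simp [van, eval_linearPolynomial]
  obtain ⟨A₀, hA⟩ := exists_finset_sign_eval₂
    (Finset.univ.image gram ∪ Finset.univ.image iso ∪ Finset.univ.image van)
  refine isSemialgebraicCoord_of_sign A₀ fun x y hxy hx => ?_
  -- The existential describes the complement, so a bad frame `v` for `y` is transferred to one for
  -- `x`; equations survive because sign zero is preserved.
  by_contra hy
  refine (notMem_image_nonvanishingForms_iff hdim hω β e x).2 ?_ hx
  obtain ⟨v, h₁, h₂, h₃⟩ := (notMem_image_nonvanishingForms_iff hdim hω β e y).1 hy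
  obtain ⟨w, hw⟩ := hA (MvPolynomial.eval y) (MvPolynomial.eval x)
    (fun a ha => (hxy a ha).symm) v
  have hzero : ∀ p ∈ Finset.univ.image gram ∪ Finset.univ.image iso ∪ Finset.univ.image van,
      p.eval₂ (MvPolynomial.eval y) v = 0 → p.eval₂ (MvPolynomial.eval x) w = 0 := by
    intro p hp h0
    rw [← sign_eq_zero_iff, ← hw p hp, h0, sign_zero]
  refine ⟨w, fun i j => ?_, fun i j => ?_, fun b => ?_⟩
  · rw [← sub_eq_zero, ← hgram (i, j) x w]
    exact hzero _ (Finset.mem_union_left _ (Finset.mem_union_left _ (Finset.mem_image_of_mem _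
      (Finset.mem_univ _)))) ((hgram (i, j) y v).trans (sub_eq_zero.2 (h₁ i j)))
  · rw [← hiso (i, j) x w]
    exact hzero _ (Finset.mem_union_left _ (Finset.mem_union_right _ (Finset.mem_image_of_mem _
      (Finset.mem_univ _)))) ((hiso (i, j) y v).trans (h₂ i j))
  · rw [← hvan b x w]
    exact hzero _ (Finset.mem_union_right _ (Finset.mem_image_of_mem _ (Finset.mem_univ _)))
      ((hvan b y v).trans (h₃ b))

end Lagrangian

end LagrangianForms

/-- The space of primitive forms carries its canonical topology as a finite-dimensional real
vector space, which is the module topology. -/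
theorem mainTheorem5 {V : Type*} [AddCommGroup V] [Module ℝ V] [FiniteDimensional ℝ V]
    (n : ℕ) (hdim : Module.finrank ℝ V = 2 * n)
    (ω : V [⋀^Fin 2]→ₗ[ℝ] ℝ) (hω : LagrangianForms.IsSymplecticForm ω) :
    IsOpen[moduleTopology ℝ (LagrangianForms.primitiveForms ω n)]
        (LagrangianForms.nonvanishingForms ω n) ∧
      LagrangianForms.IsSemialgebraic (LagrangianForms.nonvanishingForms ω n) := by
  constructor
  · let e := (Module.finBasis ℝ (LagrangianForms.primitiveForms ω n)).equivFun
    let _ : TopologicalSpace (LagrangianForms.primitiveForms ω n) := moduleTopology ℝ _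
    have : IsModuleTopology ℝ (LagrangianForms.primitiveForms ω n) := ⟨rfl⟩
    -- Linear maps out of the module topology are continuous, so openness pulls back from
    -- coordinates.
    have h := (LagrangianForms.isOpen_image_nonvanishingForms hdim hω (Module.finBasis ℝ V) e).preimage
      (IsModuleTopology.continuous_of_linearMap (R := ℝ) e.toLinearMap)
    rwa [LinearEquiv.coe_toLinearMap, Set.preimage_image_eq _ e.injective] at h
  · exact fun m e => LagrangianForms.isSemialgebraicCoord_image_nonvanishingForms hdim hω
      (Module.finBasis ℝ V) e
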